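/- Let $\mathbb T$ be the unit circle with normalized arc length. For $f\in L^\infty(\mathbb T)$ (complex valued) put $\hat f(n)=\frac1{2\pi}\int_0^{2\pi}f(e^{it})e^{-int}\,dt$, $n\in\mathbb Z$, and let the Toeplitz operator $T_f\in B(\ell^2(\mathbb N))$ be the bounded operator with matrix $(\hat f(i-j))_{i,j}$. Let $H^\infty_0(\mathbb T)$ be the set of $f\in L^\infty(\mathbb T)$ with $\hat f(n)=0$ for all $n\le 0$. For $A\subseteq\mathbb N$ let $P_A$ be the diagonal projection on $\ell^2(\mathbb N)$ onto the coordinates in $A$. An $r$-paving of $\mathbb N$ is a family $A_1,\dots,A_r$ of pairwise disjoint subsets of $\mathbb N$ with $\mathbb N=A_1\cup\dots\cup A_r$. **Theorem.** The following are equivalent: (i) for each $\epsilon>0$ there exists $r_1$ such that for every $h\in L^\infty(\mathbb T)$ for which $T_h$ is self-adjoint and $\hat h(0)=0$, there is an $r_1$-paving $\{A_1,\dots,A_{r_1}\}$ of $\mathbb N$ such that $\|P_{A_i}T_hP_{A_i}\|\le\epsilon\|T_h\|$ for $i=1,\dots,r_1$; (ii) for each $\epsilon>0$ there exists $r_2$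 such that for every $f\in H^\infty_0(\mathbb T)$ there is an $r_2$-paving $\{A_1,\dots,A_{r_2}\}$ of $\mathbb N$ such that $\|P_{A_i}T_fP_{A_i}\|\le\epsilon\|T_f\|$ for $i=1,\dots,r_2$. -/

import Mathlib

open MeasureTheory AddCircle
open scoped ENNReal InnerProductSpace

noncomputable section

namespace ToeplitzPaving

instance factTwoPiPos : Fact (0 < 2 * Real.pi) := ⟨Real.two_pi_pos⟩

/-- The unit circle `𝕋`, a point `e^{it}` being recorded by its angle `t ∈ ℝ / 2πℤ`. -/
abbrev Torus : Type := AddCircle (2 * Real.pi)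

/-- Normalized arc length `dt / 2π` on the circle. -/
abbrev arcMeasure : Measure Torus := haarAddCircle

/-- `L^∞(𝕋)`. -/
abbrev LInfty : Type := Lp ℂ ∞ arcMeasure

/-- `L²(𝕋)`. -/
abbrev LTwo : Type := Lp ℂ 2 arcMeasure

/-- The Hilbert space `ℓ²(ℕ)`. -/
abbrev EllTwo : Type := lp (fun _ : ℕ => ℂ) 2

/-- The canonical orthonormal basis of `ℓ²(ℕ)`. -/
def e (n : ℕ) : EllTwo := lp.single 2 n (1 : ℂ)

/-- The Fourier coefficient `f̂(n) = (1/2π) ∫₀^{2π} f(e^{it}) e^{-int} dt`. -/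
def coeff (f : LInfty) (n : ℤ) : ℂ := fourierCoeff (f : Torus → ℂ) n

theorem coeff_eq_integral (f : LInfty) (n : ℤ) :
    coeff f n = (1 / (2 * Real.pi) : ℂ) *
      ∫ t in (0 : ℝ)..(2 * Real.pi),
        (f : Torus → ℂ) (t : Torus) * Complex.exp (-(Complex.I * n * t)) := by
  have hpi : (Real.pi : ℂ) ≠ 0 := by exact_mod_cast Real.pi_ne_zero
  rw [coeff, fourierCoeff_eq_intervalIntegral _ n 0, zero_add, Complex.real_smul]
  push_cast
  congr 1
  refine intervalIntegral.integral_congr fun t _ => ?_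
  simp only [fourier_coe_apply, smul_eq_mul]
  rw [mul_comm]
  congr 2
  push_cast
  field_simp

/-- `H^∞_0(𝕋)`: the functions in `L^∞(𝕋)` with `f̂(n) = 0` for all `n ≤ 0`. -/
def HInftyZero : Set LInfty := {f | ∀ n : ℤ, n ≤ 0 → coeff f n = 0}

/-- Multiplication by `f ∈ L^∞(𝕋)` as a bounded operator on `L²(𝕋)`. -/
def mulOp (f : LInfty) : LTwo →L[ℂ] LTwo :=
  (ContinuousLinearMap.mul ℂ ℂ).holderL arcMeasure ∞ 2 2 f

/-- The isometry `ℓ²(ℕ) → L²(𝕋)` that sends the `n`-th basis vector to `e^{int}`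
(its range is the Hardy space `H²`). -/
def hardyEmbedding : EllTwo →ₗᵢ[ℂ] LTwo :=
  ((orthonormal_fourier (T := 2 * Real.pi)).comp (fun n : ℕ => (n : ℤ))
    Nat.cast_injective).orthogonalFamily.linearIsometry

/-- The Toeplitz operator `T_f` on `ℓ²(ℕ)`: the bounded operator with matrix `(f̂(i - j))`
(see `toeplitz_matrix` and `toeplitz_unique`), obtained by compressing multiplication by `f`
to the Hardy space. -/
def toeplitz (f : LInfty) : EllTwo →L[ℂ] EllTwo :=
  ContinuousLinearMap.adjoint hardyEmbedding.toContinuousLinearMap ∘L mulOp f ∘L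
    hardyEmbedding.toContinuousLinearMap

theorem hardyEmbedding_e (n : ℕ) :
    hardyEmbedding (e n) = fourierLp (T := 2 * Real.pi) 2 (n : ℤ) := by
  simp [hardyEmbedding, e, OrthogonalFamily.linearIsometry_apply_single]

/-- The `(i, j)` entry of the matrix of `T_f` is `f̂(i - j)`. -/
theorem toeplitz_matrix (f : LInfty) (i j : ℕ) :
    ⟪e i, toeplitz f (e j)⟫_ℂ = coeff f ((i : ℤ) - (j : ℤ)) := by
  have h : toeplitz f (e j) =
      ContinuousLinearMap.adjoint hardyEmbedding.toContinuousLinearMap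
        (mulOp f (hardyEmbedding (e j))) := rfl
  rw [h, ContinuousLinearMap.adjoint_inner_right]
  change ⟪hardyEmbedding (e i), _⟫_ℂ = _
  rw [hardyEmbedding_e, hardyEmbedding_e, L2.inner_def, coeff, fourierCoeff]
  refine integral_congr_ae ?_
  filter_upwards [coeFn_fourierLp (T := 2 * Real.pi) 2 (i : ℤ),
    coeFn_fourierLp (T := 2 * Real.pi) 2 (j : ℤ),
    ContinuousLinearMap.coeFn_holder (r := 2) (ContinuousLinearMap.mul ℂ ℂ) f
      (fourierLp (T := 2 * Real.pi) 2 (j : ℤ))] with t h1 h2 h3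
  have h3' : (mulOp f (fourierLp 2 (j : ℤ)) : Torus → ℂ) t =
      (f : Torus → ℂ) t * fourier (T := 2 * Real.pi) (j : ℤ) t := by
    rw [← h2]; exact h3
  rw [h1, h3', RCLike.inner_apply, ← fourier_neg, smul_eq_mul, neg_sub, sub_eq_add_neg,
    fourier_add]
  ring

/-- A bounded operator on `ℓ²(ℕ)` is determined by its matrix. -/
theorem toeplitz_unique (f : LInfty) (S : EllTwo →L[ℂ] EllTwo)
    (hS : ∀ i j : ℕ, ⟪e i, S (e j)⟫_ℂ = coeff f ((i : ℤ) - (j : ℤ))) : S = toeplitz f := by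
  refine lp.ext_continuousLinearMap (by norm_num) fun j => ?_
  refine ContinuousLinearMap.ext_ring ?_
  change S (e j) = toeplitz f (e j)
  ext i
  have h := (hS i j).trans (toeplitz_matrix f i j).symm
  simpa [e, lp.inner_single_left] using h

/-- The diagonal projection `P_A`: the coordinates in `A` are kept, the others become `0`. -/
def diagProj (A : Set ℕ) : EllTwo →L[ℂ] EllTwo :=
  LinearMap.mkContinuous
    { toFun := fun x => ⟨A.indicator (x : ℕ → ℂ),
        (lp.memℓp x).mono' fun n => norm_indicator_le_norm_self (x : ℕ → ℂ) n⟩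
      map_add' := fun x y => Subtype.ext (Set.indicator_add A (x : ℕ → ℂ) (y : ℕ → ℂ))
      map_smul' := fun c x => Subtype.ext (Set.indicator_const_smul A c (x : ℕ → ℂ)) }
    1 fun x => by
      rw [one_mul]
      exact lp.norm_mono (by norm_num) fun n => norm_indicator_le_norm_self (x : ℕ → ℂ) n

@[simp]
theorem diagProj_apply (A : Set ℕ) (x : EllTwo) (n : ℕ) :
    diagProj A x n = A.indicator (x : ℕ → ℂ) n := rfl

/-- `A 0, …, A (r - 1)` is an `r`-paving of `ℕ`: the sets are pairwise disjoint and
their union is `ℕ`. -/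
structure IsPaving {r : ℕ} (A : Fin r → Set ℕ) : Prop where
  disjoint : Pairwise fun i j => Disjoint (A i) (A j)
  cover : ⋃ i, A i = Set.univ

end ToeplitzPaving

end

noncomputable section

namespace ToeplitzPaving

/-! From (i) to (ii): the real and imaginary parts of `f` have self-adjoint Toeplitz operators with
zero diagonal and norm at most `‖T_f‖`. A common refinement of their pavings paves `T_f`.

From (ii) to (i): put `M = ‖T_h‖`. The symbol `h` is real with `|h| ≤ M` (`symbol_real_bounded`), so
for `c > 1` the weight `cM + h` is bounded away from `0` and equals `|g|²` with `g` analytic of mean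
`β > 0` (`exists_analytic_factor`). Then `f = g - β` lies in `H^∞_0`, and a paving of `T_f` makes `P
T_g P` close to `βP`. Since `T_g* T_g ≤ cM + T_h`, this gives roughly `β² P ≤ P (cM + T_h) P`. The
method needs `β²` close to `cM`: it is at least the harmonic mean of `cM + h`, and because `h` has
mean zero the first-order term of `1/(cM + h)` drops out, so `β² ≥ (c - 1/(c-1)) M`
(`integral_inv_le`). Hence `P T_h P` is bounded below by a small negative multiple of `M`; the same
argument for `-h` on a common refinement bounds its norm.

The factor `g` comes from a wandering vector: the part `ψ` of `w^{-1/2}` orthogonal to `w^{-1/2}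
zH²` has constant modulus, and `g = w^{1/2} ψ / ‖ψ‖`. -/

/-- The character `e^{int}` as an element of `L^∞(𝕋)`. -/
abbrev charInfty (n : ℤ) : LInfty := fourierLp (T := 2 * Real.pi) ∞ n

/-- The character `e^{int}` as an element of `L²(𝕋)`. -/
abbrev charTwo (n : ℤ) : LTwo := fourierLp (T := 2 * Real.pi) 2 n

/-! ### Multiplication operators and characters on `L²`. -/

theorem mulOp_coeFn (f : LInfty) (x : LTwo) :
    (mulOp f x : Torus → ℂ) =ᵐ[arcMeasure] fun t => f t * x t :=
  ContinuousLinearMap.coeFn_holder (r := 2) (ContinuousLinearMap.mul ℂ ℂ) f x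

theorem mulOp_comm (f g : LInfty) (x : LTwo) : mulOp f (mulOp g x) = mulOp g (mulOp f x) := by
  apply Lp.ext
  filter_upwards [mulOp_coeFn f (mulOp g x), mulOp_coeFn g (mulOp f x), mulOp_coeFn f x,
    mulOp_coeFn g x] with t h1 h2 h3 h4
  rw [h1, h2, h3, h4]; ring

theorem mulOp_charInfty_charTwo (m n : ℤ) : mulOp (charInfty m) (charTwo n) = charTwo (m + n) := by
  apply Lp.ext
  filter_upwards [mulOp_coeFn (charInfty m) (charTwo n), coeFn_fourierLp (T := 2 * Real.pi) ∞ m,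
    coeFn_fourierLp (T := 2 * Real.pi) 2 n, coeFn_fourierLp (T := 2 * Real.pi) 2 (m + n)]
    with t h1 h2 h3 h4
  rw [h1, h2, h3, h4, fourier_add]

theorem inner_charTwo (m n : ℤ) : ⟪charTwo m, charTwo n⟫_ℂ = if m = n then 1 else 0 :=
  orthonormal_iff_ite.mp (orthonormal_fourier (T := 2 * Real.pi)) m n

theorem inner_charTwo_left (n : ℤ) (x : LTwo) :
    ⟪charTwo n, x⟫_ℂ = fourierCoeff (x : Torus → ℂ) n := by
  rw [L2.inner_def, fourierCoeff]
  refine integral_congr_ae ?_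
  filter_upwards [coeFn_fourierLp (T := 2 * Real.pi) 2 n] with t h1
  rw [h1, RCLike.inner_apply, ← fourier_neg, smul_eq_mul, mul_comm]

theorem inner_mulOp_charInfty (n : ℤ) (x y : LTwo) :
    ⟪mulOp (charInfty n) x, mulOp (charInfty n) y⟫_ℂ = ⟪x, y⟫_ℂ := by
  rw [L2.inner_def, L2.inner_def]
  refine integral_congr_ae ?_
  filter_upwards [mulOp_coeFn (charInfty n) x, mulOp_coeFn (charInfty n) y,
    coeFn_fourierLp (T := 2 * Real.pi) ∞ n] with t h1 h2 h3
  rw [h1, h2, h3]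
  simp only [RCLike.inner_apply, map_mul]
  have : fourier n t * (starRingEnd ℂ) (fourier n t) = 1 := by
    rw [← fourier_neg, ← fourier_add]; simp
  linear_combination (y t * (starRingEnd ℂ) (x t)) * this

/-! ### Spectral factorization. -/

/-- Finite measures on the circle with the same Fourier coefficients are equal. -/
theorem measure_ext_of_fourier {P Q : Measure Torus} [IsFiniteMeasure P] [IsFiniteMeasure Q]
    (h : ∀ n : ℤ, ∫ t, fourier n t ∂P = ∫ t, fourier n t ∂Q) : P = Q := by
  have hc : ∀ (μ : Measure Torus) [IsFiniteMeasure μ],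
      Continuous fun q : C(Torus, ℂ) => ∫ t, q t ∂μ := by
    intro μ _
    have := (continuous_integral (μ := μ) (G := ℂ)).comp
      (ContinuousMap.toLp (E := ℂ) 1 μ ℂ).continuous
    refine this.congr fun q => ?_
    exact integral_congr_ae (ContinuousMap.coeFn_toLp (p := 1) (𝕜 := ℂ) μ q)
  have hi : ∀ (μ : Measure Torus) [IsFiniteMeasure μ] (q : C(Torus, ℂ)),
      Integrable (fun t => q t) μ := fun μ _ q =>
    Integrable.of_bound q.continuous.aestronglyMeasurable ‖q‖ (.of_forall q.norm_coe_le_norm)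
  -- The test functions on which the two integrals agree form a closed subspace containing the
  -- characters, whose span is dense.
  let K : Submodule ℂ C(Torus, ℂ) :=
    { carrier := {q | ∫ t, q t ∂P = ∫ t, q t ∂Q}
      zero_mem' := by simp
      add_mem' := fun {a b} ha hb => by
        simp only [Set.mem_ofPred_eq, ContinuousMap.add_apply] at *
        rw [integral_add (hi P a) (hi P b), integral_add (hi Q a) (hi Q b), ha, hb]
      smul_mem' := fun c a ha => by
        simp only [Set.mem_ofPred_eq, ContinuousMap.smul_apply] at *
        rw [integral_smul, integral_smul, ha] }
  have hK : ∀ q : C(Torus, ℂ), q ∈ K := by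
    have : (⊤ : Submodule ℂ C(Torus, ℂ)) ≤ K := by
      rw [← span_fourier_closure_eq_top]
      refine Submodule.topologicalClosure_minimal _ (Submodule.span_le.mpr ?_)
        (isClosed_eq (hc P) (hc Q))
      rintro _ ⟨n, rfl⟩
      exact h n
    exact fun q => this trivial
  refine ext_of_forall_integral_eq_of_IsFiniteMeasure fun f => ?_
  have := hK ⟨fun t => (f t : ℂ), by fun_prop⟩
  change ∫ t, (f t : ℂ) ∂P = ∫ t, (f t : ℂ) ∂Q at this
  rw [integral_complex_ofReal, integral_complex_ofReal] at this
  exact_mod_cast this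

/-- An `L²` function orthogonal to its shifts by `e^{int}`, `n > 0`, has constant modulus. -/
theorem norm_sq_const_of_inner_shift_eq_zero (ψ : LTwo)
    (h : ∀ n : ℕ, ⟪ψ, mulOp (charInfty (n + 1)) ψ⟫_ℂ = 0) :
    ∀ᵐ t ∂arcMeasure, ‖ψ t‖ ^ 2 = ‖ψ‖ ^ 2 := by
  have hval : ∀ n : ℤ, ∫ t, fourier n t * ((‖ψ t‖ ^ 2 : ℝ) : ℂ) ∂arcMeasure =
      ⟪ψ, mulOp (charInfty n) ψ⟫_ℂ := by
    intro n
    rw [L2.inner_def]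
    refine integral_congr_ae ?_
    filter_upwards [mulOp_coeFn (charInfty n) ψ, coeFn_fourierLp (T := 2 * Real.pi) ∞ n]
      with t h1 h2
    rw [h1, h2, RCLike.inner_apply, mul_assoc, Complex.mul_conj, Complex.normSq_eq_norm_sq]
  -- These are the Fourier coefficients of the real function `|ψ|²`, so the negative frequencies
  -- follow from the positive ones by conjugation.
  have hne : ∀ n : ℤ, n ≠ 0 → ⟪ψ, mulOp (charInfty n) ψ⟫_ℂ = 0 := by
    intro n hn
    rcases lt_or_gt_of_ne hn with hn | hn
    · obtain ⟨k, hk⟩ := Int.eq_ofNat_of_zero_le (show 0 ≤ -n - 1 by omega)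
      have hn' : -n = k + 1 := by omega
      have h2 := h k
      rw [← hn', ← hval] at h2
      rw [← hval, ← map_eq_zero (starRingEnd ℂ), ← integral_conj, ← h2]
      refine integral_congr_ae (.of_forall fun t => ?_)
      simp only [map_mul, Complex.conj_ofReal, fourier_neg]
    · obtain ⟨k, hk⟩ := Int.eq_ofNat_of_zero_le (show 0 ≤ n - 1 by omega)
      rw [show n = k + 1 by omega]
      exact h k
  have hzero : mulOp (charInfty 0) ψ = ψ := by
    apply Lp.ext
    filter_upwards [mulOp_coeFn (charInfty 0) ψ, coeFn_fourierLp (T := 2 * Real.pi) ∞ 0]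
      with t h1 h2
    rw [h1, h2]; simp
  have hmeas : AEMeasurable (fun t => ENNReal.ofReal (‖ψ t‖ ^ 2)) arcMeasure :=
    ((Lp.aestronglyMeasurable ψ).norm.aemeasurable.pow_const 2).ennreal_ofReal
  have hint : Integrable (fun t => ‖ψ t‖ ^ 2) arcMeasure :=
    (memLp_two_iff_integrable_sq_norm (Lp.aestronglyMeasurable ψ)).mp (Lp.memLp ψ)
  have hfin : ∫⁻ t, ENNReal.ofReal (‖ψ t‖ ^ 2) ∂arcMeasure ≠ ∞ := by
    exact (hint.lintegral_lt_top).ne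
  have : IsFiniteMeasure (arcMeasure.withDensity fun t => ENNReal.ofReal (‖ψ t‖ ^ 2)) :=
    isFiniteMeasure_withDensity hfin
  have : IsFiniteMeasure (arcMeasure.withDensity fun _ => ENNReal.ofReal (‖ψ‖ ^ 2)) := by
    exact isFiniteMeasure_withDensity (by simp)
  have key : (arcMeasure.withDensity fun t => ENNReal.ofReal (‖ψ t‖ ^ 2)) =
      arcMeasure.withDensity fun _ => ENNReal.ofReal (‖ψ‖ ^ 2) := by
    refine measure_ext_of_fourier fun n => ?_
    rw [integral_withDensity_eq_integral_toReal_smul₀ hmeas (.of_forall fun _ => by simp),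
      integral_withDensity_eq_integral_toReal_smul₀ (by fun_prop) (.of_forall fun _ => by simp)]
    have h1 : ∀ t, (ENNReal.ofReal (‖ψ t‖ ^ 2)).toReal • fourier n t =
        fourier n t * ((‖ψ t‖ ^ 2 : ℝ) : ℂ) := fun t => by
      rw [ENNReal.toReal_ofReal (by positivity), Complex.real_smul, mul_comm]
    simp only [h1]
    rw [hval, integral_smul, ENNReal.toReal_ofReal (by positivity)]
    have h2 := inner_charTwo 0 n
    rw [inner_charTwo_left, fourierCoeff_congr_ae (coeFn_fourierLp (T := 2 * Real.pi) 2 n),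
      fourierCoeff] at h2
    simp only [neg_zero, fourier_zero, one_smul] at h2
    rw [h2]
    by_cases hn : n = 0
    · subst hn
      rw [hzero, inner_self_eq_norm_sq_to_K]
      simp
    · rw [hne n hn, if_neg (Ne.symm hn), smul_zero]
  have := (withDensity_eq_iff hmeas aemeasurable_const hfin).mp key
  filter_upwards [this] with t ht
  exact (ENNReal.ofReal_eq_ofReal_iff (by positivity) (by positivity)).mp ht

/-- A wandering vector: for shifts `S n` of an orthonormal family `c` and an operator `V`
commuting with them and with left inverse `U`, the component `ψ` of `V (c 0)` orthogonal to all
`V (c n)`, `n > 0`, is orthogonal to its own positive shifts. -/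
theorem exists_wandering_vector {H : Type*} [NormedAddCommGroup H] [InnerProductSpace ℂ H]
    [CompleteSpace H] {c : ℤ → H} (hc : Orthonormal ℂ c) (S : ℤ → H →L[ℂ] H) (U V : H →L[ℂ] H)
    (hUV : ∀ x, U (V x) = x) (hSV : ∀ n x, S n (V x) = V (S n x))
    (hSc : ∀ m n, S m (c n) = c (m + n)) :
    ∃ ψ : H, (∀ n : ℕ, ⟪ψ, S (n + 1) ψ⟫_ℂ = 0) ∧ ‖ψ‖ ≤ ‖V (c 0)‖ ∧
      ∀ m : ℤ, m ≤ 0 → ⟪c m, U ψ⟫_ℂ = if m = 0 then 1 else 0 := by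
  have hcc := orthonormal_iff_ite.mp hc
  let K : Submodule ℂ H :=
    (Submodule.span ℂ (Set.range fun n : ℕ => V (c (n + 1)))).topologicalClosure
  have hgen : ∀ n : ℕ, V (c (n + 1)) ∈ K := fun n =>
    Submodule.le_topologicalClosure _ (Submodule.subset_span ⟨n, rfl⟩)
  have hK : ∀ L : Submodule ℂ H, IsClosed (L : Set H) →
      (∀ n : ℕ, V (c (n + 1)) ∈ L) → K ≤ L := fun L hL h =>
    Submodule.topologicalClosure_minimal _ (Submodule.span_le.mpr (by rintro _ ⟨n, rfl⟩; exact h n))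
      hL
  have hKclosed : IsClosed (K : Set H) := Submodule.isClosed_topologicalClosure _
  have : CompleteSpace K := hKclosed.completeSpace_coe
  have hshift : ∀ (n : ℕ), ∀ k ∈ K, S (n + 1) k ∈ K := fun n =>
    hK (K.comap (S (n + 1)).toLinearMap) (hKclosed.preimage (S (n + 1)).continuous) fun m => by
      change S (n + 1) (V (c (m + 1))) ∈ K
      rw [hSV, hSc]
      convert hgen (n + m + 1) using 3
      push_cast; ring
  -- `U` undoes `V`, so it maps `K` into the closed span of the `c n` with `n > 0`; subtracting the
  -- projection `p` therefore leaves the coefficients of index `≤ 0` unchanged.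
  have horth : ∀ m : ℤ, m ≤ 0 → ∀ k ∈ K, ⟪c m, U k⟫_ℂ = 0 := fun m hm =>
    hK (LinearMap.ker ((innerSL ℂ (c m)).comp U).toLinearMap)
      (ContinuousLinearMap.isClosed_ker ((innerSL ℂ (c m)).comp U)) fun n => by
        change ⟪c m, U (V (c (n + 1)))⟫_ℂ = 0
        rw [hUV, hcc, if_neg (by omega)]
  set y := V (c 0) with hy
  set p := K.starProjection y with hp
  have hpK : p ∈ K := K.starProjection_apply_mem y
  have hψ : ∀ k ∈ K, ⟪y - p, k⟫_ℂ = 0 := fun k hk => K.starProjection_inner_eq_zero y k hk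
  refine ⟨y - p, fun n => hψ _ ?_, ?_, fun m hm => ?_⟩
  · rw [map_sub]
    refine K.sub_mem ?_ (hshift n p hpK)
    rw [hy, hSV, hSc]
    simpa using hgen n
  · have h2 : ‖(y - p) + p‖ * ‖(y - p) + p‖ = ‖y - p‖ * ‖y - p‖ + ‖p‖ * ‖p‖ :=
      norm_add_sq_eq_norm_sq_add_norm_sq_of_inner_eq_zero _ _ (hψ p hpK)
    rw [sub_add_cancel] at h2
    nlinarith [norm_nonneg (y - p), norm_nonneg y, norm_nonneg p]
  · rw [map_sub, inner_sub_right, horth m hm p hpK, hy, hUV, hcc, sub_zero]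

/-- For a bounded invertible `v` with inverse `u`, the component `ψ` of `v` orthogonal to
`v · zH²` has constant modulus, and `uψ` is analytic with zeroth coefficient `1`. -/
theorem exists_orthogonal_component (u v : LInfty)
    (huv : ∀ᵐ t ∂arcMeasure, u t * v t = 1) :
    ∃ ψ : LTwo, (∀ᵐ t ∂arcMeasure, ‖ψ t‖ ^ 2 = ‖ψ‖ ^ 2) ∧ ‖ψ‖ ≤ ‖mulOp v (charTwo 0)‖ ∧
      ∀ m : ℤ, m ≤ 0 → ⟪charTwo m, mulOp u ψ⟫_ℂ = if m = 0 then 1 else 0 := by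
  have hinv : ∀ x, mulOp u (mulOp v x) = x := fun x => by
    apply Lp.ext
    filter_upwards [mulOp_coeFn u (mulOp v x), mulOp_coeFn v x, huv] with t h1 h2 h3
    rw [h1, h2, ← mul_assoc, h3, one_mul]
  obtain ⟨ψ, h1, h2, h3⟩ := exists_wandering_vector (orthonormal_fourier (T := 2 * Real.pi))
    (fun n => mulOp (charInfty n)) (mulOp u) (mulOp v) hinv (fun n => mulOp_comm _ _)
    mulOp_charInfty_charTwo
  exact ⟨ψ, norm_sq_const_of_inner_shift_eq_zero ψ h1, h2, h3⟩

/-- Spectral factorization: a weight `w` bounded above and away from `0` is `|g|²` for an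
analytic `g` whose mean is at least the square root of the harmonic mean of `w`. -/
theorem exists_analytic_factor {w : Torus → ℝ} (hw : AEStronglyMeasurable w arcMeasure) {a b : ℝ}
    (ha : 0 < a) (hab : ∀ᵐ t ∂arcMeasure, a ≤ w t ∧ w t ≤ b) :
    ∃ g : LInfty, (∀ᵐ t ∂arcMeasure, ‖g t‖ ^ 2 = w t) ∧ (∀ n : ℤ, n < 0 → coeff g n = 0) ∧
      ∃ β : ℝ, 0 < β ∧ coeff g 0 = β ∧ 1 ≤ β ^ 2 * ∫ t, (w t)⁻¹ ∂arcMeasure := by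
  have hsq : AEStronglyMeasurable (fun t => √(w t)) arcMeasure :=
    Real.continuous_sqrt.comp_aestronglyMeasurable hw
  have hu : MemLp (fun t => ((√(w t) : ℝ) : ℂ)) ∞ arcMeasure := by
    refine memLp_top_of_bound (Complex.continuous_ofReal.comp_aestronglyMeasurable hsq) √b ?_
    filter_upwards [hab] with t ht
    rw [Complex.norm_real, Real.norm_of_nonneg (Real.sqrt_nonneg _)]
    exact Real.sqrt_le_sqrt ht.2
  have hv : MemLp (fun t => (((√(w t))⁻¹ : ℝ) : ℂ)) ∞ arcMeasure := by
    refine memLp_top_of_bound (Complex.continuous_ofReal.comp_aestronglyMeasurable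
      hsq.aemeasurable.inv.aestronglyMeasurable) (√a)⁻¹ ?_
    filter_upwards [hab] with t ht
    rw [Complex.norm_real, Real.norm_of_nonneg (by positivity)]
    exact inv_anti₀ (Real.sqrt_pos.mpr ha) (Real.sqrt_le_sqrt ht.1)
  -- Applied with `u = √w` and `v = 1/√w`: the normalized product `uψ/‖ψ‖` has modulus `√w` and mean
  -- `1/‖ψ‖`, while `‖ψ‖² ≤ ‖v‖² = ∫ 1/w`.
  obtain ⟨ψ, hψ, hψle, hψc⟩ := exists_orthogonal_component (hu.toLp _) (hv.toLp _) (by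
    filter_upwards [hu.coeFn_toLp, hv.coeFn_toLp, hab] with t h1 h2 h3
    rw [h1, h2, ← Complex.ofReal_mul, mul_inv_cancel₀, Complex.ofReal_one]
    exact (Real.sqrt_pos.mpr (ha.trans_le h3.1)).ne')
  have hψ0 : 0 < ‖ψ‖ := by
    rw [norm_pos_iff]
    rintro rfl
    have := hψc 0 le_rfl
    simp at this
  set φ := mulOp (hu.toLp _) ψ with hφ
  have hφsq : ∀ᵐ t ∂arcMeasure, ‖((‖ψ‖⁻¹ : ℝ) : ℂ) * φ t‖ ^ 2 = w t := by
    filter_upwards [hψ, mulOp_coeFn (hu.toLp _) ψ, hu.coeFn_toLp, hab] with t h1 h2 h3 h4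
    rw [h2, h3, norm_mul, norm_mul, Complex.norm_real, Complex.norm_real, mul_pow, mul_pow, h1,
      Real.norm_of_nonneg (Real.sqrt_nonneg _), Real.sq_sqrt (ha.le.trans h4.1),
      Real.norm_of_nonneg (by positivity)]
    field_simp
  have hg : MemLp (fun t => ((‖ψ‖⁻¹ : ℝ) : ℂ) * φ t) ∞ arcMeasure := by
    refine memLp_top_of_bound ((Lp.aestronglyMeasurable φ).const_mul _) √b ?_
    filter_upwards [hφsq, hab] with t h1 h2
    exact Real.le_sqrt_of_sq_le (h1.le.trans h2.2)
  have hcoeff : ∀ n : ℤ, n ≤ 0 → coeff (hg.toLp _) n = if n = 0 then ((‖ψ‖⁻¹ : ℝ) : ℂ) else 0 := by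
    intro n hn
    rw [coeff, fourierCoeff_congr_ae hg.coeFn_toLp, fourierCoeff.const_mul,
      ← inner_charTwo_left, hψc n hn]
    simp
  refine ⟨hg.toLp _, ?_, fun n hn => ?_, ‖ψ‖⁻¹, by positivity, ?_, ?_⟩
  · filter_upwards [hg.coeFn_toLp, hφsq] with t h1 h2
    rw [h1, h2]
  · rw [hcoeff n hn.le, if_neg hn.ne]
  · rw [hcoeff 0 le_rfl, if_pos rfl]
  · have hI : ‖mulOp (hv.toLp _) (charTwo 0)‖ ^ 2 = ∫ t, (w t)⁻¹ ∂arcMeasure := by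
      have h1 := inner_self_eq_norm_sq_to_K (𝕜 := ℂ) (mulOp (hv.toLp _) (charTwo 0))
      rw [L2.inner_def] at h1
      have h2 : ∫ t, (((w t)⁻¹ : ℝ) : ℂ) ∂arcMeasure =
          ((‖mulOp (hv.toLp _) (charTwo 0)‖ : ℝ) : ℂ) ^ 2 := by
        refine Eq.trans (integral_congr_ae ?_) h1
        filter_upwards [mulOp_coeFn (hv.toLp _) (charTwo 0), hv.coeFn_toLp, hab,
          coeFn_fourierLp (T := 2 * Real.pi) 2 0] with t h1 h2 h3 h4
        rw [h1, h2, h4, inner_self_eq_norm_sq_to_K]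
        simp only [fourier_zero, mul_one, Complex.norm_real, norm_inv,
          Real.norm_of_nonneg (Real.sqrt_nonneg _)]
        norm_cast
        rw [inv_pow, Real.sq_sqrt (ha.le.trans h3.1)]
        rfl
      rw [integral_complex_ofReal] at h2
      exact_mod_cast h2.symm
    rw [← hI, inv_pow, inv_mul_eq_div, one_le_div (by positivity)]
    exact pow_le_pow_left₀ hψ0.le hψle 2

/-! ### Algebra of Toeplitz operators and Fourier coefficients. -/

theorem inner_toeplitz (f : LInfty) (x y : EllTwo) :
    ⟪x, toeplitz f y⟫_ℂ = ⟪hardyEmbedding x, mulOp f (hardyEmbedding y)⟫_ℂ :=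
  ContinuousLinearMap.adjoint_inner_right hardyEmbedding.toContinuousLinearMap x
    (mulOp f (hardyEmbedding y))

theorem toeplitz_add (f g : LInfty) : toeplitz (f + g) = toeplitz f + toeplitz g := by
  simp [toeplitz, mulOp, ContinuousLinearMap.comp_add, ContinuousLinearMap.add_comp]

theorem toeplitz_smul (c : ℂ) (f : LInfty) : toeplitz (c • f) = c • toeplitz f := by
  simp [toeplitz, mulOp, ContinuousLinearMap.smul_comp]

/-- Every integer is the difference of its positive and negative parts, so each coefficient is a
matrix entry and inherits linearity from `toeplitz`. -/
theorem coeff_eq_inner_toeplitz (f : LInfty) (n : ℤ) :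
    coeff f n = ⟪e n.toNat, toeplitz f (e (-n).toNat)⟫_ℂ := by
  rw [toeplitz_matrix]; congr 1; omega

theorem coeff_add (f g : LInfty) (n : ℤ) : coeff (f + g) n = coeff f n + coeff g n := by
  simp only [coeff_eq_inner_toeplitz, toeplitz_add, add_apply, inner_add_right]

theorem coeff_smul (c : ℂ) (f : LInfty) (n : ℤ) : coeff (c • f) n = c * coeff f n := by
  simp only [coeff_eq_inner_toeplitz, toeplitz_smul, smul_apply, inner_smul_right]

theorem coeff_charInfty_zero (n : ℤ) : coeff (charInfty 0) n = if n = 0 then 1 else 0 := by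
  rw [coeff, fourierCoeff_congr_ae (coeFn_fourierLp (T := 2 * Real.pi) ∞ 0),
    ← fourierCoeff_congr_ae (coeFn_fourierLp (T := 2 * Real.pi) 2 0), ← inner_charTwo_left,
    inner_charTwo]

theorem inner_e (i j : ℕ) : ⟪e i, e j⟫_ℂ = if i = j then 1 else 0 := by
  rw [e, lp.inner_single_left, e, lp.single_apply]
  by_cases h : i = j <;> simp [h]

theorem toeplitz_charInfty_zero : toeplitz (charInfty 0) = ContinuousLinearMap.id ℂ EllTwo := by
  refine (toeplitz_unique _ _ fun i j => ?_).symm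
  rw [coeff_charInfty_zero, ContinuousLinearMap.id_apply, inner_e]
  simp [sub_eq_zero]

theorem coeff_star (f : LInfty) (n : ℤ) : coeff (star f) n = starRingEnd ℂ (coeff f (-n)) := by
  rw [coeff, coeff, fourierCoeff, fourierCoeff, ← integral_conj]
  refine integral_congr_ae ?_
  filter_upwards [Lp.coeFn_star f] with t ht
  rw [ht, smul_eq_mul, smul_eq_mul, map_mul, ← fourier_neg, neg_neg (-n)]
  rfl

theorem toeplitz_star (f : LInfty) :
    toeplitz (star f) = ContinuousLinearMap.adjoint (toeplitz f) := by
  refine (toeplitz_unique _ _ fun i j => ?_).symm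
  rw [ContinuousLinearMap.adjoint_inner_right, ← inner_conj_symm, toeplitz_matrix, coeff_star,
    neg_sub]

/-! ### Recovering the symbol from the operator. -/

theorem charTwo_mem_range_hardyEmbedding {n : ℤ} (hn : 0 ≤ n) :
    charTwo n ∈ LinearMap.range hardyEmbedding.toLinearMap :=
  ⟨e n.toNat, by
    change hardyEmbedding (e n.toNat) = _
    rw [hardyEmbedding_e, Int.toNat_of_nonneg hn]⟩

/-- Every trigonometric polynomial is shifted into the Hardy space by a high enough power. -/
theorem exists_shift_mem_range {q : LTwo} (hq : q ∈ Submodule.span ℂ (Set.range charTwo)) :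
    ∃ N : ℤ, ∀ m ≥ N, mulOp (charInfty m) q ∈ LinearMap.range hardyEmbedding.toLinearMap := by
  induction hq using Submodule.span_induction with
  | mem x hx =>
    obtain ⟨n, rfl⟩ := hx
    refine ⟨-n, fun m hm => ?_⟩
    rw [mulOp_charInfty_charTwo]
    exact charTwo_mem_range_hardyEmbedding (by omega)
  | zero => exact ⟨0, fun m _ => by rw [map_zero]; exact Submodule.zero_mem _⟩
  | add x y _ _ hx hy =>
    obtain ⟨N, hN⟩ := hx
    obtain ⟨N', hN'⟩ := hy
    refine ⟨max N N', fun m hm => ?_⟩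
    rw [map_add]
    exact Submodule.add_mem _ (hN m (le_of_max_le_left hm)) (hN' m (le_of_max_le_right hm))
  | smul c x _ hx =>
    obtain ⟨N, hN⟩ := hx
    refine ⟨N, fun m hm => ?_⟩
    rw [map_smul]
    exact Submodule.smul_mem _ c (hN m hm)

/-- The numerical range of multiplication by `h` is contained in the closure of that of `T_h`. -/
theorem inner_mulOp_mem_of_isClosed (h : LInfty) {C : Set (ℂ × ℝ)} (hC : IsClosed C)
    (hT : ∀ x : EllTwo, (⟪x, toeplitz h x⟫_ℂ, ‖x‖) ∈ C) (q : LTwo) :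
    (⟪q, mulOp h q⟫_ℂ, ‖q‖) ∈ C := by
  have hcl : IsClosed {q : LTwo | (⟪q, mulOp h q⟫_ℂ, ‖q‖) ∈ C} :=
    hC.preimage (by fun_prop)
  have hsub : (Submodule.span ℂ (Set.range charTwo) : Set LTwo) ⊆
      {q : LTwo | (⟪q, mulOp h q⟫_ℂ, ‖q‖) ∈ C} := by
    intro q hq
    obtain ⟨N, hN⟩ := exists_shift_mem_range hq
    obtain ⟨x, hx⟩ := hN N le_rfl
    replace hx : hardyEmbedding x = mulOp (charInfty N) q := hx
    have h1 := hT x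
    have h2 : ‖mulOp (charInfty N) q‖ = ‖q‖ := by
      -- Multiplication by a character is isometric and commutes with multiplication by `h`, so
      -- shifting `q` into the Hardy space changes neither its norm nor its quadratic form.
      rw [← sq_eq_sq₀ (norm_nonneg _) (norm_nonneg _), ← inner_self_eq_norm_sq (𝕜 := ℂ),
        inner_mulOp_charInfty, inner_self_eq_norm_sq]
    rwa [inner_toeplitz, ← hardyEmbedding.norm_map x, hx, mulOp_comm, inner_mulOp_charInfty,
      h2] at h1
  have hd : closure (Submodule.span ℂ (Set.range charTwo) : Set LTwo) = Set.univ := by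
    have := span_fourierLp_closure_eq_top (T := 2 * Real.pi) (p := 2) (by simp)
    rw [← Submodule.topologicalClosure_coe]
    exact (congrArg (fun K : Submodule ℂ LTwo => (K : Set LTwo)) this).trans Submodule.top_coe
  exact hcl.closure_subset_iff.mpr hsub (hd ▸ Set.mem_univ q)

theorem integrable_LInfty (h : LInfty) : Integrable h arcMeasure :=
  (Lp.memLp h).integrable le_top

/-- The symbol of a self-adjoint Toeplitz operator is real and bounded by the operator norm. -/
theorem symbol_real_bounded {h : LInfty} (hsa : IsSelfAdjoint (toeplitz h)) :
    ∀ᵐ t ∂arcMeasure, h t = ((h t).re : ℂ) ∧ |(h t).re| ≤ ‖toeplitz h‖ := by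
  set M := ‖toeplitz h‖ with hM
  have hq := inner_mulOp_mem_of_isClosed h
    (C := {z : ℂ × ℝ | z.1.im = 0 ∧ |z.1.re| ≤ M * z.2 ^ 2})
    ((isClosed_eq (f := fun z : ℂ × ℝ => z.1.im) (g := fun _ => 0) (by fun_prop)
      (by fun_prop)).inter (isClosed_le (f := fun z : ℂ × ℝ => |z.1.re|)
        (g := fun z => M * z.2 ^ 2) (by fun_prop) (by fun_prop)))
    fun x => by
      constructor
      · exact hsa.isSymmetric.im_inner_self_apply x
      · calc |(⟪x, toeplitz h x⟫_ℂ).re| ≤ ‖⟪x, toeplitz h x⟫_ℂ‖ := Complex.abs_re_le_norm _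
          _ ≤ ‖x‖ * ‖toeplitz h x‖ := norm_inner_le_norm _ _
          _ ≤ ‖x‖ * (M * ‖x‖) := by gcongr; exact (toeplitz h).le_opNorm x
          _ = M * ‖x‖ ^ 2 := by ring
  -- Testing the quadratic form on indicators turns its bounds into bounds on set integrals of `h`.
  have hs : ∀ s, MeasurableSet s → (∫ t in s, (h t).im ∂arcMeasure) = 0 ∧
      |∫ t in s, (h t).re ∂arcMeasure| ≤ M * arcMeasure.real s := by
    intro s hs
    have h1 := hq (indicatorConstLp 2 hs (measure_ne_top _ s) (1 : ℂ))
    have h2 : ⟪indicatorConstLp 2 hs (measure_ne_top _ s) (1 : ℂ),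
        mulOp h (indicatorConstLp 2 hs (measure_ne_top _ s) (1 : ℂ))⟫_ℂ =
        ∫ t in s, h t ∂arcMeasure := by
      rw [L2.inner_indicatorConstLp_one]
      refine setIntegral_congr_ae hs ?_
      filter_upwards [mulOp_coeFn h (indicatorConstLp 2 hs (measure_ne_top _ s) (1 : ℂ)),
        indicatorConstLp_coeFn (p := 2) (hs := hs) (hμs := measure_ne_top arcMeasure s)
          (c := (1 : ℂ))] with t h1 h2 hts
      rw [h1, h2, Set.indicator_of_mem hts, mul_one]
    rw [h2, norm_indicatorConstLp (by simp) (by simp)] at h1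
    obtain ⟨h3, h4⟩ := h1
    have hI := (integrable_LInfty h).integrableOn (s := s)
    refine ⟨?_, ?_⟩
    · rw [← h3]
      exact integral_im hI
    · refine (congrArg abs (integral_re hI)).le.trans (h4.trans (le_of_eq ?_))
      simp only [norm_one, one_mul]
      congr 1
      rw [← Real.rpow_natCast, ← Real.rpow_mul measureReal_nonneg]
      simp
  have him : (fun t => (h t).im) =ᵐ[arcMeasure] 0 :=
    Integrable.ae_eq_zero_of_forall_setIntegral_eq_zero (integrable_LInfty h).im
      fun s hms _ => (hs s hms).1
  have hre : Integrable (fun t => (h t).re) arcMeasure := (integrable_LInfty h).re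
  have hle : (fun t => (h t).re) ≤ᵐ[arcMeasure] fun _ => M :=
    ae_le_of_forall_setIntegral_le hre (integrable_const _) fun s hms _ => by
      rw [setIntegral_const, smul_eq_mul, mul_comm _ M]
      exact (le_abs_self _).trans (hs s hms).2
  have hge : (fun _ => -M) ≤ᵐ[arcMeasure] fun t => (h t).re :=
    ae_le_of_forall_setIntegral_le (integrable_const _) hre fun s hms _ => by
      rw [setIntegral_const, smul_eq_mul, mul_neg, mul_comm _ M]
      exact (neg_le_of_abs_le (hs s hms).2)
  filter_upwards [him, hle, hge] with t h1 h2 h3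
  exact ⟨Complex.ext rfl h1, abs_le.mpr ⟨h3, h2⟩⟩

/-! ### Comparison of `T_g* T_g` with `T_h`. -/

/-- If `|g|² = κ + h` then `T_g* T_g ≤ κ + T_h`. -/
theorem norm_toeplitz_sq_le {g h : LInfty} {κ : ℝ}
    (hgh : ∀ᵐ t ∂arcMeasure, ((‖g t‖ ^ 2 : ℝ) : ℂ) = κ + h t) (x : EllTwo) :
    ‖toeplitz g x‖ ^ 2 ≤ κ * ‖x‖ ^ 2 + (⟪x, toeplitz h x⟫_ℂ).re := by
  have key : ∀ y : LTwo, ‖mulOp g y‖ ^ 2 = κ * ‖y‖ ^ 2 + (⟪y, mulOp h y⟫_ℂ).re := by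
    intro y
    have h1 : ⟪mulOp g y, mulOp g y⟫_ℂ = ⟪y, (κ : ℂ) • y + mulOp h y⟫_ℂ := by
      rw [L2.inner_def, L2.inner_def]
      refine integral_congr_ae ?_
      filter_upwards [mulOp_coeFn g y, mulOp_coeFn h y, hgh, Lp.coeFn_smul (κ : ℂ) y,
        Lp.coeFn_add ((κ : ℂ) • y) (mulOp h y)] with t h1 h2 h3 h4 h5
      rw [h5, Pi.add_apply, h4, Pi.smul_apply, h1, h2]
      simp only [RCLike.inner_apply, map_mul, smul_eq_mul]
      rw [← Complex.normSq_eq_norm_sq, ← Complex.mul_conj] at h3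
      linear_combination (y t * (starRingEnd ℂ) (y t)) * h3
    rw [inner_add_right, inner_smul_right] at h1
    have h2 := congrArg Complex.re h1
    rw [Complex.add_re, Complex.re_ofReal_mul] at h2
    have h3 := inner_self_eq_norm_sq (𝕜 := ℂ) (mulOp g y)
    have h4 := inner_self_eq_norm_sq (𝕜 := ℂ) y
    simp only [RCLike.re_to_complex] at h3 h4
    rwa [h3, h4] at h2
  -- Compressing back to the Hardy space can only decrease the norm; this is the sole source of
  -- inequality.
  have h1 : ‖toeplitz g x‖ ≤ ‖mulOp g (hardyEmbedding x)‖ := by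
    change ‖ContinuousLinearMap.adjoint hardyEmbedding.toContinuousLinearMap
      (mulOp g (hardyEmbedding x))‖ ≤ _
    refine (ContinuousLinearMap.le_opNorm _ _).trans (mul_le_of_le_one_left (norm_nonneg _) ?_)
    rw [LinearIsometryEquiv.norm_map]
    exact hardyEmbedding.norm_toContinuousLinearMap_le
  calc ‖toeplitz g x‖ ^ 2 ≤ ‖mulOp g (hardyEmbedding x)‖ ^ 2 := by gcongr
    _ = κ * ‖x‖ ^ 2 + (⟪x, toeplitz h x⟫_ℂ).re := by
      rw [key, inner_toeplitz, hardyEmbedding.norm_map]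

/-! ### Diagonal projections, compressions and pavings. -/

theorem norm_e (n : ℕ) : ‖e n‖ = 1 := by
  rw [← sq_eq_sq₀ (norm_nonneg _) zero_le_one, ← inner_self_eq_norm_sq (𝕜 := ℂ), inner_e]; simp

theorem norm_diagProj_apply_le (A : Set ℕ) (x : EllTwo) : ‖diagProj A x‖ ≤ ‖x‖ :=
  lp.norm_mono (by norm_num) fun n => norm_indicator_le_norm_self (x : ℕ → ℂ) n

theorem norm_diagProj_le_one (A : Set ℕ) : ‖diagProj A‖ ≤ 1 :=
  ContinuousLinearMap.opNorm_le_bound _ zero_le_one fun x => by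
    rw [one_mul]; exact norm_diagProj_apply_le A x

theorem diagProj_comp (A B : Set ℕ) : diagProj A ∘L diagProj B = diagProj (A ∩ B) := by
  ext x n
  change A.indicator (B.indicator (x : ℕ → ℂ)) n = (A ∩ B).indicator (x : ℕ → ℂ) n
  rw [Set.indicator_indicator]

theorem isSelfAdjoint_diagProj (A : Set ℕ) : IsSelfAdjoint (diagProj A) := by
  rw [ContinuousLinearMap.isSelfAdjoint_iff_isSymmetric]
  intro x y
  change ⟪diagProj A x, y⟫_ℂ = ⟪x, diagProj A y⟫_ℂ
  rw [lp.inner_eq_tsum, lp.inner_eq_tsum]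
  refine tsum_congr fun n => ?_
  simp only [diagProj_apply]
  by_cases hn : n ∈ A <;> simp [hn]

/-- The compression `P_A T P_A`. -/
abbrev compression (A : Set ℕ) (T : EllTwo →L[ℂ] EllTwo) : EllTwo →L[ℂ] EllTwo :=
  diagProj A ∘L T ∘L diagProj A

theorem norm_compression_mono {A B : Set ℕ} (h : A ⊆ B) (T : EllTwo →L[ℂ] EllTwo) :
    ‖compression A T‖ ≤ ‖compression B T‖ := by
  have h1 : compression A T = diagProj A ∘L compression B T ∘L diagProj A := by
    have h2 := diagProj_comp A B
    have h3 := diagProj_comp B A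
    rw [Set.inter_eq_left.mpr h] at h2
    rw [Set.inter_eq_right.mpr h] at h3
    change diagProj A ∘L T ∘L diagProj A =
      (diagProj A ∘L diagProj B) ∘L T ∘L (diagProj B ∘L diagProj A)
    rw [h2, h3]
  rw [h1]
  calc _ ≤ ‖diagProj A‖ * (‖compression B T‖ * ‖diagProj A‖) :=
        (ContinuousLinearMap.opNorm_comp_le _ _).trans
          (mul_le_mul_of_nonneg_left (ContinuousLinearMap.opNorm_comp_le _ _) (norm_nonneg _))
    _ ≤ 1 * (‖compression B T‖ * 1) := by
        gcongr <;> exact norm_diagProj_le_one A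
    _ = _ := by ring

theorem inner_compression (A : Set ℕ) (T : EllTwo →L[ℂ] EllTwo) (x : EllTwo) :
    ⟪x, compression A T x⟫_ℂ = ⟪diagProj A x, T (diagProj A x)⟫_ℂ :=
  ((isSelfAdjoint_diagProj A).isSymmetric x (T (diagProj A x))).symm

/-- Two pavings have a common refinement. -/
theorem IsPaving.exists_refinement {r s : ℕ} {A : Fin r → Set ℕ} {B : Fin s → Set ℕ}
    (hA : IsPaving A) (hB : IsPaving B) :
    ∃ C : Fin (r * s) → Set ℕ, IsPaving C ∧ ∀ k, ∃ i j, C k ⊆ A i ∧ C k ⊆ B j := by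
  refine ⟨fun k => A (finProdFinEquiv.symm k).1 ∩ B (finProdFinEquiv.symm k).2, ⟨?_, ?_⟩,
    fun k => ⟨_, _, Set.inter_subset_left, Set.inter_subset_right⟩⟩
  · intro k l hkl
    have : finProdFinEquiv.symm k ≠ finProdFinEquiv.symm l := fun h =>
      hkl (finProdFinEquiv.symm.injective h)
    by_cases h1 : (finProdFinEquiv.symm k).1 = (finProdFinEquiv.symm l).1
    · have h2 : (finProdFinEquiv.symm k).2 ≠ (finProdFinEquiv.symm l).2 := fun h2 =>
        this (Prod.ext h1 h2)
      exact (hB.disjoint h2).mono Set.inter_subset_right Set.inter_subset_right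
    · exact (hA.disjoint h1).mono Set.inter_subset_left Set.inter_subset_left
  · refine Set.eq_univ_of_forall fun n => ?_
    obtain ⟨i, hi⟩ := Set.mem_iUnion.mp (hA.cover ▸ Set.mem_univ n)
    obtain ⟨j, hj⟩ := Set.mem_iUnion.mp (hB.cover ▸ Set.mem_univ n)
    exact Set.mem_iUnion.mpr ⟨finProdFinEquiv (i, j), by simpa using ⟨hi, hj⟩⟩

/-- The norm of a self-adjoint operator is the supremum of its absolute Rayleigh quotients; this
converts the two one-sided bounds for `T_h` and `-T_h` into a norm bound. -/
theorem norm_le_of_abs_re_inner_le {H : Type*} [NormedAddCommGroup H] [InnerProductSpace ℂ H]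
    [CompleteSpace H] {B : H →L[ℂ] H} (hB : IsSelfAdjoint B) {δ : ℝ} (hδ : 0 ≤ δ)
    (h : ∀ x, |(⟪x, B x⟫_ℂ).re| ≤ δ * ‖x‖ ^ 2) : ‖B‖ ≤ δ := by
  rw [ContinuousLinearMap.norm_eq_iSup_rayleighQuotient _ hB.isSymmetric]
  refine ciSup_le fun x => ?_
  rw [ContinuousLinearMap.rayleighQuotient, ContinuousLinearMap.reApplyInnerSelf_apply, abs_div,
    abs_sq, inner_re_symm]
  exact div_le_of_le_mul₀ (by positivity) hδ (h x)

/-! ### The lower bound for compressions of `T_h`. -/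

/-- With `a = cM`, expand `1/(a+k) = 1/a - k/a² + k²/(a²(a+k))`. The linear term integrates to zero,
and the remainder is controlled by `k² ≤ M²` and `a + k ≥ (c-1)M`. -/
theorem integral_inv_le {k : Torus → ℝ} (hk : Integrable k arcMeasure)
    (hk0 : ∫ t, k t ∂arcMeasure = 0) {M c : ℝ} (hM : 0 < M) (hc : 1 < c)
    (hb : ∀ᵐ t ∂arcMeasure, |k t| ≤ M) :
    ∫ t, (c * M + k t)⁻¹ ∂arcMeasure ≤ (c * M)⁻¹ + (c ^ 2 * (c - 1) * M)⁻¹ := by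
  have hc' : 0 < c - 1 := sub_pos.mpr hc
  have hI : Integrable (fun t => (c * M)⁻¹ + (c ^ 2 * (c - 1) * M)⁻¹ - ((c * M) ^ 2)⁻¹ * k t)
      arcMeasure := (integrable_const _).sub (hk.const_mul _)
  calc ∫ t, (c * M + k t)⁻¹ ∂arcMeasure
      ≤ ∫ t, ((c * M)⁻¹ + (c ^ 2 * (c - 1) * M)⁻¹ - ((c * M) ^ 2)⁻¹ * k t) ∂arcMeasure := by
        refine integral_mono_of_nonneg ?_ hI ?_
        · filter_upwards [hb] with t ht
          have := (abs_le.mp ht).1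
          exact inv_nonneg.mpr (by nlinarith)
        · filter_upwards [hb] with t ht
          obtain ⟨h1, h2⟩ := abs_le.mp ht
          have hw : (c - 1) * M ≤ c * M + k t := by linarith
          have hw0 : 0 < (c - 1) * M := by positivity
          have hid : (c * M + k t)⁻¹ = (c * M)⁻¹ - ((c * M) ^ 2)⁻¹ * k t +
              k t ^ 2 * ((c * M) ^ 2 * (c * M + k t))⁻¹ := by
            have : c * M + k t ≠ 0 := (hw0.trans_le hw).ne'
            have : c ≠ 0 := by linarith
            field_simp
            ring
          have hle : k t ^ 2 * ((c * M) ^ 2 * (c * M + k t))⁻¹ ≤ (c ^ 2 * (c - 1) * M)⁻¹ := by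
            calc k t ^ 2 * ((c * M) ^ 2 * (c * M + k t))⁻¹
                ≤ M ^ 2 * ((c * M) ^ 2 * ((c - 1) * M))⁻¹ := by
                  refine mul_le_mul (sq_le_sq' h1 h2) ?_ ?_ (sq_nonneg M)
                  · gcongr
                  · have := hw0.trans_le hw
                    positivity
              _ = (c ^ 2 * (c - 1) * M)⁻¹ := by field_simp
          rw [hid]; linarith
    _ = _ := by
        rw [integral_sub (integrable_const _) (hk.const_mul _), integral_const_mul, hk0]
        simp

/-- If `T_h` is self-adjoint with zero diagonal, some `f ∈ H^∞_0` is such that a small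
compression of `T_f` makes the same compression of `T_h` bounded below by a small quantity. -/
theorem exists_analytic_compression_lower_bound {h : LInfty} (hsa : IsSelfAdjoint (toeplitz h))
    (h0 : coeff h 0 = 0) (hM : 0 < ‖toeplitz h‖) {c : ℝ} (hc : 1 < c) :
    ∃ f ∈ HInftyZero, ∀ (A : Set ℕ) (ε : ℝ), 0 < ε →
      ‖compression A (toeplitz f)‖ ≤ ε * ‖toeplitz f‖ → ∀ x : EllTwo,
        -((1 / (c - 1) + 4 * ε * (c + 1)) * ‖toeplitz h‖) * ‖diagProj A x‖ ^ 2 ≤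
          (⟪x, compression A (toeplitz h) x⟫_ℂ).re := by
  set M := ‖toeplitz h‖ with hMdef
  have hc' : 0 < c - 1 := sub_pos.mpr hc
  have hsym := symbol_real_bounded hsa
  have hre : Integrable (fun t => (h t).re) arcMeasure := (integrable_LInfty h).re
  have hre0 : ∫ t, (h t).re ∂arcMeasure = 0 := by
    have h1 : ∫ t, (h t).re ∂arcMeasure = (∫ t, h t ∂arcMeasure).re :=
      integral_re (integrable_LInfty h)
    have h2 : coeff h 0 = ∫ t, h t ∂arcMeasure := by simp [coeff, fourierCoeff]
    rw [h1, ← h2, h0, Complex.zero_re]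
  obtain ⟨g, hg, hgneg, β, hβ, hg0, hβI⟩ := exists_analytic_factor
    (w := fun t => c * M + (h t).re) (a := (c - 1) * M) (b := (c + 1) * M)
    (hre.aestronglyMeasurable.const_add _) (by positivity) (by
      filter_upwards [hsym] with t ht
      obtain ⟨h1, h2⟩ := abs_le.mp ht.2
      constructor <;> linarith)
  have hgh : ∀ x, ‖toeplitz g x‖ ^ 2 ≤ c * M * ‖x‖ ^ 2 + (⟪x, toeplitz h x⟫_ℂ).re :=
    norm_toeplitz_sq_le (by
      filter_upwards [hg, hsym] with t h1 h2
      rw [h1, Complex.ofReal_add, ← h2.1])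
  -- The integral bound gives `β² ≥ c²(c-1)M / (c(c-1)+1)`, and `(c - 1/(c-1))(c(c-1)+1) = c²(c-1) -
  -- 1/(c-1)`.
  have hβsq : (c - 1 / (c - 1)) * M ≤ β ^ 2 := by
    have h1 : 1 ≤ β ^ 2 * ((c * M)⁻¹ + (c ^ 2 * (c - 1) * M)⁻¹) :=
      hβI.trans (mul_le_mul_of_nonneg_left
        (integral_inv_le hre hre0 hM hc (hsym.mono fun t ht => ht.2)) (sq_nonneg β))
    have h2 : (c * M)⁻¹ + (c ^ 2 * (c - 1) * M)⁻¹ =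
        (c * (c - 1) + 1) / (c ^ 2 * (c - 1) * M) := by
      have : c ≠ 0 := by linarith
      field_simp
    have hc0 : 0 < c := by linarith
    rw [h2, mul_div_assoc', one_le_div (by positivity)] at h1
    have h3 : (c - 1 / (c - 1)) * M * (c * (c - 1) + 1) =
        c ^ 2 * (c - 1) * M - M / (c - 1) := by
      field_simp
      ring
    have h4 : 0 < M / (c - 1) := by positivity
    have h5 : 0 < c * (c - 1) + 1 := by positivity
    exact le_of_mul_le_mul_right (by linarith) h5
  have hgnorm : ‖toeplitz g‖ ≤ √((c + 1) * M) := by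
    refine ContinuousLinearMap.opNorm_le_bound _ (Real.sqrt_nonneg _) fun x => ?_
    refine abs_le_of_sq_le_sq' ?_ (by positivity) |>.2
    rw [mul_pow, Real.sq_sqrt (by nlinarith)]
    have h1 : (⟪x, toeplitz h x⟫_ℂ).re ≤ ‖x‖ * (M * ‖x‖) :=
      (Complex.re_le_norm _).trans ((norm_inner_le_norm _ _).trans
        (mul_le_mul_of_nonneg_left ((toeplitz h).le_opNorm x) (norm_nonneg _)))
    nlinarith [hgh x]
  have hβle : β ≤ √((c + 1) * M) := by
    have h1 : ⟪e 0, toeplitz g (e 0)⟫_ℂ = β := by rw [toeplitz_matrix, ← hg0]; simp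
    have h2 := norm_inner_le_norm (𝕜 := ℂ) (e 0) (toeplitz g (e 0))
    rw [h1, norm_e, one_mul, Complex.norm_real, Real.norm_of_nonneg hβ.le] at h2
    have h3 := (toeplitz g).le_opNorm (e 0)
    rw [norm_e, mul_one] at h3
    exact h2.trans (h3.trans hgnorm)
  set f : LInfty := g + (-β : ℂ) • charInfty 0 with hf
  have hTf : toeplitz f = toeplitz g - (β : ℂ) • ContinuousLinearMap.id ℂ EllTwo := by
    rw [hf, toeplitz_add, toeplitz_smul, toeplitz_charInfty_zero, neg_smul, sub_eq_add_neg]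
  have hfnorm : ‖toeplitz f‖ ≤ 2 * √((c + 1) * M) := by
    rw [hTf]
    refine (norm_sub_le _ _).trans ?_
    have : ‖(β : ℂ) • ContinuousLinearMap.id ℂ EllTwo‖ ≤ β := by
      rw [norm_smul, Complex.norm_real, Real.norm_of_nonneg hβ.le]
      exact mul_le_of_le_one_right hβ.le ContinuousLinearMap.norm_id_le
    linarith
  refine ⟨f, fun n hn => ?_, fun A ε hε hA x => ?_⟩
  · rw [hf, coeff_add, coeff_smul, coeff_charInfty_zero]
    rcases hn.lt_or_eq with hn | rfl
    · simp [hgneg n hn, hn.ne]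
    · simp [hg0]
  · rw [inner_compression]
    set y := diagProj A x with hy
    have hyy : diagProj A y = y := by
      have := congrArg (fun S : EllTwo →L[ℂ] EllTwo => S x) (diagProj_comp A A)
      simpa using this
    set R := √((c + 1) * M) with hR
    have hRsq : R ^ 2 = (c + 1) * M := Real.sq_sqrt (by nlinarith)
    have h1 : diagProj A (toeplitz g y) = (β : ℂ) • y + compression A (toeplitz f) y := by
      change _ = _ + diagProj A (toeplitz f (diagProj A y))
      rw [hyy, hTf, sub_apply, smul_apply, ContinuousLinearMap.id_apply,
        map_sub, map_smul, hyy, add_sub_cancel]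
    have h2 : ‖compression A (toeplitz f) y‖ ≤ 2 * R * ε * ‖y‖ := by
      refine (ContinuousLinearMap.le_opNorm _ _).trans ?_
      gcongr
      exact hA.trans (by nlinarith)
    have h3 : β * ‖y‖ - 2 * R * ε * ‖y‖ ≤ ‖toeplitz g y‖ := by
      have h4 := norm_diagProj_apply_le A (toeplitz g y)
      have h5 := norm_sub_le_norm_add ((β : ℂ) • y) (compression A (toeplitz f) y)
      rw [← h1, norm_smul, Complex.norm_real, Real.norm_of_nonneg hβ.le] at h5
      linarith
    have hR0 : 0 ≤ R := Real.sqrt_nonneg _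
    have h4 : (β ^ 2 - 4 * β * R * ε) * ‖y‖ ^ 2 ≤ ‖toeplitz g y‖ ^ 2 := by
      -- If the lower bound in `h3` is nonpositive it cannot be squared, but then the left side of
      -- the goal is nonpositive too.
      rcases le_total 0 (β * ‖y‖ - 2 * R * ε * ‖y‖) with h | h
      · refine le_trans ?_ (pow_le_pow_left₀ h h3 2)
        nlinarith [sq_nonneg (2 * R * ε * ‖y‖)]
      · refine le_trans ?_ (sq_nonneg _)
        have : 0 ≤ β * R * ε * ‖y‖ ^ 2 := by positivity
        nlinarith [mul_nonneg hβ.le (norm_nonneg y)]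
    -- Using `β ≤ R` makes the error linear in `M`, as the conclusion requires.
    have h5 : β * R * ε ≤ (c + 1) * M * ε := by
      rw [← hRsq, sq]; gcongr
    have h6 := hgh y
    have h7 : ((c - 1 / (c - 1)) * M - 4 * ((c + 1) * M * ε)) * ‖y‖ ^ 2 ≤
        (β ^ 2 - 4 * β * R * ε) * ‖y‖ ^ 2 := by
      refine mul_le_mul_of_nonneg_right ?_ (sq_nonneg _)
      linarith
    rw [show -((1 / (c - 1) + 4 * ε * (c + 1)) * M) =
      (c - 1 / (c - 1)) * M - 4 * ((c + 1) * M * ε) - c * M by ring, sub_mul]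
    linarith

/-! ### The two implications. -/

/-- Paving of self-adjoint Toeplitz operators implies paving of analytic ones. -/
theorem paving_analytic_of_paving_selfAdjoint
    (H : ∀ ε : ℝ, 0 < ε → ∃ r : ℕ, ∀ h : LInfty, IsSelfAdjoint (toeplitz h) → coeff h 0 = 0 →
      ∃ A : Fin r → Set ℕ, IsPaving A ∧
        ∀ i, ‖compression (A i) (toeplitz h)‖ ≤ ε * ‖toeplitz h‖)
    {ε : ℝ} (hε : 0 < ε) : ∃ r : ℕ, ∀ f ∈ HInftyZero, ∃ A : Fin r → Set ℕ, IsPaving A ∧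
      ∀ i, ‖compression (A i) (toeplitz f)‖ ≤ ε * ‖toeplitz f‖ := by
  -- Half of `ε` goes to each of the real and imaginary parts.
  obtain ⟨r, hr⟩ := H (ε / 2) (by positivity)
  refine ⟨r * r, fun f hf => ?_⟩
  have hf0 : coeff f 0 = 0 := hf 0 le_rfl
  have hstar : ContinuousLinearMap.adjoint (toeplitz f) = star (toeplitz f) := rfl
  have hns : ‖star (toeplitz f)‖ = ‖toeplitz f‖ := by
    rw [← hstar, LinearIsometryEquiv.norm_map]
  have hT1 : toeplitz ((1 / 2 : ℂ) • (f + star f)) =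
      (1 / 2 : ℂ) • (toeplitz f + star (toeplitz f)) := by
    rw [toeplitz_smul, toeplitz_add, toeplitz_star, hstar]
  have hT2 : toeplitz ((-Complex.I / 2 : ℂ) • (f + (-1 : ℂ) • star f)) =
      (-Complex.I / 2 : ℂ) • (toeplitz f + (-1 : ℂ) • star (toeplitz f)) := by
    rw [toeplitz_smul, toeplitz_add, toeplitz_smul, toeplitz_star, hstar]
  have hsa1 : IsSelfAdjoint (toeplitz ((1 / 2 : ℂ) • (f + star f))) := by
    rw [hT1, isSelfAdjoint_iff, star_smul, star_add, star_star, add_comm]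
    congr 1
    simp
  have hsa2 : IsSelfAdjoint (toeplitz ((-Complex.I / 2 : ℂ) • (f + (-1 : ℂ) • star f))) := by
    rw [hT2, isSelfAdjoint_iff, star_smul, star_add, star_smul, star_star]
    simp only [star_div₀, star_neg, star_one, star_ofNat, Complex.star_def, Complex.conj_I]
    module
  have hn1 : ‖toeplitz ((1 / 2 : ℂ) • (f + star f))‖ ≤ ‖toeplitz f‖ := by
    rw [hT1, norm_smul]
    have := norm_add_le (toeplitz f) (star (toeplitz f))
    rw [hns] at this
    have h2 : ‖(1 / 2 : ℂ)‖ = 1 / 2 := by simp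
    rw [h2]; linarith
  have hn2 : ‖toeplitz ((-Complex.I / 2 : ℂ) • (f + (-1 : ℂ) • star f))‖ ≤ ‖toeplitz f‖ := by
    rw [hT2, norm_smul]
    have := norm_add_le (toeplitz f) ((-1 : ℂ) • star (toeplitz f))
    rw [norm_smul, hns, norm_neg, norm_one, one_mul] at this
    have h2 : ‖(-Complex.I / 2 : ℂ)‖ = 1 / 2 := by simp
    rw [h2]; linarith
  obtain ⟨A, hA, hA'⟩ := hr _ hsa1 (by rw [coeff_smul, coeff_add, coeff_star]; simp [hf0])
  obtain ⟨B, hB, hB'⟩ := hr _ hsa2 (by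
    rw [coeff_smul, coeff_add, coeff_smul, coeff_star]; simp [hf0])
  obtain ⟨C, hC, hC'⟩ := hA.exists_refinement hB
  refine ⟨C, hC, fun k => ?_⟩
  obtain ⟨i, j, hi, hj⟩ := hC' k
  have hsplit : toeplitz f = toeplitz ((1 / 2 : ℂ) • (f + star f)) +
      Complex.I • toeplitz ((-Complex.I / 2 : ℂ) • (f + (-1 : ℂ) • star f)) := by
    rw [hT1, hT2, smul_smul]
    have : Complex.I * (-Complex.I / 2) = 1 / 2 := by
      linear_combination (-1 / 2 : ℂ) * Complex.I_mul_I
    rw [this]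
    module
  have hcomp : compression (C k) (toeplitz f) =
      compression (C k) (toeplitz ((1 / 2 : ℂ) • (f + star f))) + Complex.I •
      compression (C k) (toeplitz ((-Complex.I / 2 : ℂ) • (f + (-1 : ℂ) • star f))) := by
    conv_lhs => rw [hsplit]
    simp only [compression, ContinuousLinearMap.add_comp, ContinuousLinearMap.comp_add,
      ContinuousLinearMap.smul_comp, ContinuousLinearMap.comp_smul]
  rw [hcomp]
  refine (norm_add_le _ _).trans ?_
  rw [norm_smul, Complex.norm_I, one_mul]
  have h1 := (norm_compression_mono hi _).trans (hA' i)
  have h2 := (norm_compression_mono hj _).trans (hB' j)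
  nlinarith

/-- Paving of analytic Toeplitz operators implies paving of self-adjoint ones. -/
theorem paving_selfAdjoint_of_paving_analytic
    (H : ∀ ε : ℝ, 0 < ε → ∃ r : ℕ, ∀ f ∈ HInftyZero, ∃ A : Fin r → Set ℕ, IsPaving A ∧
      ∀ i, ‖compression (A i) (toeplitz f)‖ ≤ ε * ‖toeplitz f‖)
    {ε : ℝ} (hε : 0 < ε) : ∃ r : ℕ, ∀ h : LInfty, IsSelfAdjoint (toeplitz h) → coeff h 0 = 0 →
      ∃ A : Fin r → Set ℕ, IsPaving A ∧
        ∀ i, ‖compression (A i) (toeplitz h)‖ ≤ ε * ‖toeplitz h‖ := by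
  -- `c` makes `1/(c-1) = ε/2`, then `δ` makes `4δ(c+1) = ε/2`. Both depend only on `ε`, so the
  -- number of pieces is uniform in `h`.
  set c : ℝ := 1 + 2 / ε with hc
  have hc1 : 1 < c := by rw [hc]; linarith [show 0 < 2 / ε by positivity]
  set δ : ℝ := ε / (8 * (c + 1)) with hδ
  have hc2 : 0 < c + 1 := by linarith
  have hδ0 : 0 < δ := by positivity
  have hconst : 1 / (c - 1) + 4 * δ * (c + 1) = ε := by
    have : c - 1 = 2 / ε := by rw [hc]; ring
    rw [this, hδ]; field_simp; ring
  obtain ⟨r, hr⟩ := H δ hδ0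
  refine ⟨r * r, fun h hsa h0 => ?_⟩
  have hneg : toeplitz ((-1 : ℂ) • h) = -toeplitz h := by rw [toeplitz_smul, neg_one_smul]
  rcases (norm_nonneg (toeplitz h)).eq_or_lt with hM | hM
  -- When `T_h = 0` any paving works, but one with exactly `r * r` pieces must exist; the zero
  -- symbol supplies one with `r` pieces, which is refined by itself.
  · obtain ⟨A, hA, -⟩ := hr 0 fun n _ => by
      rw [← zero_smul ℂ (0 : LInfty), coeff_smul, zero_mul]
    obtain ⟨C, hC, -⟩ := hA.exists_refinement hA
    refine ⟨C, hC, fun i => ?_⟩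
    rw [norm_eq_zero.mp hM.symm]
    simp [compression]
  · obtain ⟨f₁, hf₁, h₁⟩ := exists_analytic_compression_lower_bound hsa h0 hM hc1
    obtain ⟨f₂, hf₂, h₂⟩ := exists_analytic_compression_lower_bound (h := (-1 : ℂ) • h)
      (by rw [hneg]; exact hsa.neg) (by rw [coeff_smul, h0, mul_zero])
      (by rwa [hneg, norm_neg]) hc1
    obtain ⟨A, hA, hA'⟩ := hr f₁ hf₁
    obtain ⟨B, hB, hB'⟩ := hr f₂ hf₂
    obtain ⟨C, hC, hC'⟩ := hA.exists_refinement hB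
    refine ⟨C, hC, fun k => ?_⟩
    obtain ⟨i, j, hi, hj⟩ := hC' k
    have hlow := h₁ (C k) δ hδ0 ((norm_compression_mono hi _).trans (hA' i))
    have hupp := h₂ (C k) δ hδ0 ((norm_compression_mono hj _).trans (hB' j))
    rw [hneg, norm_neg] at hupp
    rw [hconst] at hlow hupp
    have hcsa : IsSelfAdjoint (compression (C k) (toeplitz h)) := by
      have h3 := hsa.conjugate_self (isSelfAdjoint_diagProj (C k))
      rwa [mul_assoc] at h3
    refine norm_le_of_abs_re_inner_le hcsa (by positivity) fun x => ?_
    have hx : ‖diagProj (C k) x‖ ^ 2 ≤ ‖x‖ ^ 2 := by gcongr; exact norm_diagProj_apply_le _ _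
    have hx' := mul_le_mul_of_nonneg_left hx (show 0 ≤ ε * ‖toeplitz h‖ by positivity)
    have h3 := hlow x
    have h4 := hupp x
    have h5 : compression (C k) (-toeplitz h) = -compression (C k) (toeplitz h) := by
      simp [compression]
    rw [h5, neg_apply, inner_neg_right, Complex.neg_re] at h4
    rw [abs_le]
    constructor <;> linarith

end ToeplitzPaving

end

theorem mainTheorem5 :
    (∀ ε : ℝ, 0 < ε → ∃ r₁ : ℕ, ∀ h : ToeplitzPaving.LInfty,
      IsSelfAdjoint (ToeplitzPaving.toeplitz h) → ToeplitzPaving.coeff h 0 = 0 →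
        ∃ A : Fin r₁ → Set ℕ, ToeplitzPaving.IsPaving A ∧
          ∀ i : Fin r₁,
            ‖ToeplitzPaving.diagProj (A i) ∘L ToeplitzPaving.toeplitz h ∘L
              ToeplitzPaving.diagProj (A i)‖ ≤ ε * ‖ToeplitzPaving.toeplitz h‖) ↔
    (∀ ε : ℝ, 0 < ε → ∃ r₂ : ℕ, ∀ f ∈ ToeplitzPaving.HInftyZero,
        ∃ A : Fin r₂ → Set ℕ, ToeplitzPaving.IsPaving A ∧
          ∀ i : Fin r₂,
            ‖ToeplitzPaving.diagProj (A i) ∘L ToeplitzPaving.toeplitz f ∘L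
              ToeplitzPaving.diagProj (A i)‖ ≤ ε * ‖ToeplitzPaving.toeplitz f‖) :=
  ⟨fun H _ hε => ToeplitzPaving.paving_analytic_of_paving_selfAdjoint H hε,
    fun H _ hε => ToeplitzPaving.paving_selfAdjoint_of_paving_analytic H hε⟩
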